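/- Let $c>0$, $\lambda>0$, and let $X(t)$, $t\ge 0$, be the Goldstein--Kac telegraph process with speed $c$ and rate $\lambda$: $X(t)=\int_0^t c\,D\,(-1)^{N(s)}\,ds$, where $N$ is a homogeneous Poisson process of rate $\lambda$ and the initial direction $D$ is independent of $N$ with $\Pr\{D=1\}=\Pr\{D=-1\}=\tfrac12$. Then for every $t>0$ and all $a,b\in\mathbb R$ with $a<b$ and $(a,b)\cap(-ct,ct)\ne\varnothing$, $$\Pr\{X(t)\in(a,b)\cap(-ct,ct)\}=\frac{\lambda e^{-\lambda t}}{2c}\sum_{k=0}^{\infty}\frac{1}{(k!)^2}\left(\frac{\lambda t}{2}\right)^{2k}\left(1+\frac{\lambda t}{2k+2}\right)\left[\beta F\left(-k,\tfrac12;\tfrac32;\tfrac{\beta^2}{c^2t^2}\right)-\alpha F\left(-k,\tfrac12;\tfrac32;\tfrac{\alpha^2}{c^2t^2}\right)\right],$$ where the series converges, $\alpha=\max\{-ct,a\}$, $\beta=\min\{ct,b\}$, and $F(\xi,\eta;\zeta;z)=\sum_{n=0}^{\infty}\frac{(\xi)_n(\eta)_n}{(\zeta)_n}\frac{z^n}{n!}$,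 with $(\xi)_n=\xi(\xi+1)\cdots(\xi+n-1)$, is the Gauss hypergeometric function. -/

import Mathlib

open MeasureTheory ProbabilityTheory
open scoped NNReal

/-- `N` is a homogeneous Poisson (counting) process of rate `lam` under `P`: it starts from `0`,
its paths are nondecreasing and right-continuous, its increments over disjoint intervals are
independent, and `N t - N s` has the Poisson law with mean `lam * (t - s)` for `s ≤ t`.
(The truncated subtraction of `ℕ` is almost surely the true one, since the paths are
nondecreasing; the subtraction `t - s` in `ℝ≥0` is used for `s ≤ t` only.) -/
structure IsPoissonProcess {Ω : Type*} [MeasurableSpace Ω] (N : ℝ≥0 → Ω → ℕ) (lam : ℝ≥0)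
    (P : Measure Ω) : Prop where
  measurable : ∀ t, Measurable (N t)
  zero : ∀ᵐ ω ∂P, N 0 ω = 0
  monotone : ∀ᵐ ω ∂P, Monotone fun t => N t ω
  rightContinuous : ∀ᵐ ω ∂P, ∀ t, ContinuousWithinAt (fun s => N s ω) (Set.Ici t) t
  indepIncrements : HasIndepIncrements N P
  law : ∀ s t, s ≤ t →
    HasLaw (fun ω => N t ω - N s ω) (poissonMeasure (lam * (t - s))) P

/-- `X` is a (Goldstein-Kac) telegraph process with speed `c` and rate `lam` under `P`: there are an
initial direction `D`, equal to `1` or `-1` with probability `1/2` each, and a homogeneous Poisson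
process `N` of rate `lam`, independent of `D`, such that the particle starts from the origin and has
at every time `s` the velocity `c * D * (-1) ^ N s`, that is, its direction is reversed at every
Poisson event. -/
def IsTelegraphProcess {Ω : Type*} [MeasurableSpace Ω] (X : ℝ≥0 → Ω → ℝ) (c : ℝ) (lam : ℝ≥0)
    (P : Measure Ω) : Prop :=
  ∃ (D : Ω → ℝ) (N : ℝ≥0 → Ω → ℕ),
    Measurable D ∧ P {ω | D ω = 1} = 1 / 2 ∧ P {ω | D ω = -1} = 1 / 2 ∧
    IsPoissonProcess N lam P ∧
    IndepFun D (fun ω t => N t ω) P ∧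
    ∀ᵐ ω ∂P, ∀ t : ℝ≥0, X t ω = ∫ s in (0 : ℝ)..t, c * D ω * (-1) ^ N s.toNNReal ω

/-! Write `X t = c * D * Y t`, where `Y t` is the integral of `(-1) ^ N s` up to `t` (`signedTime`).
The law of `Y t` is found separately on each event `N t = k`, through its Fourier transform `φ_k(t)
= E[exp (iξ Y t); N t = k]`.

Over a short time `h` the Poisson process has no event, one event, or, with probability `O(h²)`,
more. Independence of increments then gives `φ_k' = (-λ + (-1)^k iξ) φ_k + λ φ_{k-1}`
(`norm_countTransform_step_le`, `hasDerivWithinAt_countTransform`). This triangular system is solved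
by `exp (-λt) λ^k` times convolutions of `exp (±iξy) y^j / j!` (`countTransform_eq`). Such a
convolution is visibly a Fourier integral over the time `y` spent moving in the initial direction,
with `Y t = 2y - t`. Uniqueness of characteristic functions therefore yields a polynomial density in
`y` (`map_restrict_signedTime`).

With no reversal the particle sits at `±ct`, outside the open interval. For the other counts,
averaging over `D` symmetrises the density. Counts `2k + 1` and `2k + 2` then both become multiples
of `(1 - x²/t²)^k` (`reversalDensity_sum`), whose primitive is the terminating hypergeometric
function (`integral_one_sub_sq_div_pow`). Summation and convergence are countable additivity over
the values of `N t`. -/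

/-! ### Iterated integrals and convolutions of exponential monomials -/

/-- The `(k + 1)`-fold iterated integral of `H` from `0`, in the form of Cauchy's formula. -/
noncomputable def iteratedIntegral (k : ℕ) (H : ℝ → ℂ) (t : ℝ) : ℂ :=
  ∫ y in (0 : ℝ)..t, ((t : ℂ) - y) ^ k / (k.factorial : ℂ) * H y

/-- Integration by parts. Moving one integration onto `H` allows the derivative in `t` to be found
by induction on `k`, without differentiating a kernel that depends on `t`. -/
theorem iteratedIntegral_succ {H : ℝ → ℂ} (hH : Continuous H) (k : ℕ) (t : ℝ) :
    iteratedIntegral (k + 1) H t = iteratedIntegral k (fun y => ∫ x in (0 : ℝ)..y, H x) t := by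
  have hk : ((k + 1).factorial : ℂ) ≠ 0 := by exact_mod_cast Nat.factorial_ne_zero _
  have hk' : (k.factorial : ℂ) ≠ 0 := by exact_mod_cast Nat.factorial_ne_zero _
  have hH1 : Continuous fun y => ∫ x in (0 : ℝ)..y, H x :=
    intervalIntegral.continuous_primitive (fun _ _ => hH.intervalIntegrable _ _) _
  have hu : ∀ y : ℝ, HasDerivAt (fun y : ℝ => ((t : ℂ) - y) ^ (k + 1) / ((k + 1).factorial : ℂ))
      (-(((t : ℂ) - y) ^ k / (k.factorial : ℂ))) y := by
    intro y
    have h1 : HasDerivAt (fun y : ℝ => (t : ℂ) - y) (-1) y :=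
      (Complex.ofRealCLM.hasDerivAt (x := y)).const_sub (t : ℂ)
    refine ((h1.pow (k + 1)).div_const _).congr_deriv ?_
    have : ((k : ℂ) + 1) ≠ 0 := by exact_mod_cast Nat.succ_ne_zero k
    rw [Nat.factorial_succ]
    push_cast
    field_simp
  have hv : ∀ y : ℝ, HasDerivAt (fun y => ∫ x in (0 : ℝ)..y, H x) (H y) y := fun y =>
    intervalIntegral.integral_hasDerivAt_right (hH.intervalIntegrable _ _)
      (hH.stronglyMeasurableAtFilter _ _) hH.continuousAt
  have key := intervalIntegral.integral_mul_deriv_eq_deriv_mul (a := 0) (b := t)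
    (fun y _ => hu y) (fun y _ => hv y)
    ((by fun_prop : Continuous fun y : ℝ =>
      -(((t : ℂ) - y) ^ k / (k.factorial : ℂ))).intervalIntegrable _ _)
    (hH.intervalIntegrable _ _)
  unfold iteratedIntegral
  rw [key]
  simp

theorem hasDerivAt_iteratedIntegral_zero {H : ℝ → ℂ} (hH : Continuous H) (t : ℝ) :
    HasDerivAt (iteratedIntegral 0 H) (H t) t := by
  have : iteratedIntegral 0 H = fun t => ∫ x in (0 : ℝ)..t, H x := by
    ext t; simp [iteratedIntegral]
  rw [this]
  exact intervalIntegral.integral_hasDerivAt_right (hH.intervalIntegrable _ _)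
      (hH.stronglyMeasurableAtFilter _ _) hH.continuousAt

theorem hasDerivAt_iteratedIntegral_succ (k : ℕ) {H : ℝ → ℂ} (hH : Continuous H) (t : ℝ) :
    HasDerivAt (iteratedIntegral (k + 1) H) (iteratedIntegral k H t) t := by
  have hH1 : Continuous fun y => ∫ x in (0 : ℝ)..y, H x :=
    intervalIntegral.continuous_primitive (fun _ _ => hH.intervalIntegrable _ _) _
  rw [funext (iteratedIntegral_succ hH k)]
  induction k generalizing H with
  | zero =>
    refine (hasDerivAt_iteratedIntegral_zero hH1 t).congr_deriv ?_
    simp [iteratedIntegral]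
  | succ k ih =>
    rw [iteratedIntegral_succ hH k, funext (iteratedIntegral_succ hH1 k)]
    exact ih hH1 (intervalIntegral.continuous_primitive
      (fun _ _ => hH1.intervalIntegrable _ _) _)

/-- The function `y ↦ exp (a y) y ^ k / k!`. -/
noncomputable def expMonomial (a : ℂ) (k : ℕ) (y : ℝ) : ℂ :=
  Complex.exp (a * y) * (y : ℂ) ^ k / (k.factorial : ℂ)

theorem continuous_expMonomial (a : ℂ) (k : ℕ) : Continuous (expMonomial a k) := by
  unfold expMonomial
  fun_prop

/-- The convolution over `[0, t]` of two functions of the form `exp (a y) y ^ k / k!`. -/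
noncomputable def expMonomialConv (a b : ℂ) (k j : ℕ) (t : ℝ) : ℂ :=
  ∫ y in (0 : ℝ)..t, expMonomial a k y * expMonomial b j (t - y)

theorem expMonomialConv_comm (a b : ℂ) (k j : ℕ) (t : ℝ) :
    expMonomialConv a b k j t = expMonomialConv b a j k t := by
  unfold expMonomialConv
  have := intervalIntegral.integral_comp_sub_left (a := 0) (b := t)
    (fun y => expMonomial a k y * expMonomial b j (t - y)) t
  simp only [sub_sub_cancel, sub_self, sub_zero] at this
  rw [← this]
  simp_rw [mul_comm]

/-- Pulling `exp (b t)` out of the integral leaves Cauchy's kernel, so differentiating in `t`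
produces the factor `b` and lowers `j` by one. -/
theorem expMonomialConv_eq (a b : ℂ) (k j : ℕ) (t : ℝ) :
    expMonomialConv a b k j t =
      Complex.exp (b * t) * iteratedIntegral j (fun y => Complex.exp (-b * y) * expMonomial a k y) t := by
  unfold expMonomialConv iteratedIntegral
  rw [← intervalIntegral.integral_const_mul]
  congr 1
  ext y
  have : Complex.exp (b * ((t - y : ℝ) : ℂ)) = Complex.exp (b * t) * Complex.exp (-b * y) := by
    rw [← Complex.exp_add]; congr 1; push_cast; ring
  simp only [expMonomial]
  rw [this]
  push_cast
  ring

theorem hasDerivAt_expMonomialConv_zero (a b : ℂ) (k : ℕ) (t : ℝ) :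
    HasDerivAt (expMonomialConv a b k 0)
      (b * expMonomialConv a b k 0 t + expMonomial a k t) t := by
  have hc : Continuous fun y : ℝ => Complex.exp (-b * y) * expMonomial a k y := by
    have := continuous_expMonomial a k
    fun_prop
  have he : HasDerivAt (fun t : ℝ => Complex.exp (b * t)) (Complex.exp (b * t) * (b * 1)) t :=
    ((Complex.ofRealCLM.hasDerivAt (x := t)).const_mul b).cexp
  rw [funext (expMonomialConv_eq a b k 0)]
  refine (he.mul (hasDerivAt_iteratedIntegral_zero hc t)).congr_deriv ?_
  have : Complex.exp (b * t) * Complex.exp (-b * t) = 1 := by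
    rw [← Complex.exp_add]; simp
  linear_combination (expMonomial a k t) * this

theorem hasDerivAt_expMonomialConv_succ (a b : ℂ) (k j : ℕ) (t : ℝ) :
    HasDerivAt (expMonomialConv a b k (j + 1))
      (b * expMonomialConv a b k (j + 1) t + expMonomialConv a b k j t) t := by
  have hc : Continuous fun y : ℝ => Complex.exp (-b * y) * expMonomial a k y := by
    have := continuous_expMonomial a k
    fun_prop
  have he : HasDerivAt (fun t : ℝ => Complex.exp (b * t)) (Complex.exp (b * t) * (b * 1)) t :=
    ((Complex.ofRealCLM.hasDerivAt (x := t)).const_mul b).cexp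
  rw [funext (expMonomialConv_eq a b k (j + 1)), expMonomialConv_eq a b k j]
  refine (he.mul (hasDerivAt_iteratedIntegral_succ j hc t)).congr_deriv ?_
  ring

/-! ### The explicit transforms and their differential equations -/

/-- The transform at `ξ` of the unnormalised law of the signed time on `n` velocity reversals. -/
noncomputable def telegraphTransform (ξ : ℝ) : ℕ → ℝ → ℂ
  | 0, t => Complex.exp (ξ * Complex.I * t)
  | n + 1, t => expMonomialConv (ξ * Complex.I) (-(ξ * Complex.I)) ((n + 1) / 2) (n / 2) t

theorem hasDerivAt_telegraphTransform_zero (ξ t : ℝ) :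
    HasDerivAt (telegraphTransform ξ 0) (ξ * Complex.I * telegraphTransform ξ 0 t) t := by
  refine (((Complex.ofRealCLM.hasDerivAt (x := t)).const_mul (ξ * Complex.I)).cexp).congr_deriv ?_
  simp only [telegraphTransform]
  simp
  ring

theorem telegraphTransform_odd (ξ : ℝ) (k : ℕ) : telegraphTransform ξ (2 * k + 1) =
    expMonomialConv (ξ * Complex.I) (-(ξ * Complex.I)) k k := by
  have h1 : (2 * k + 1) / 2 = k := by omega
  have h2 : 2 * k / 2 = k := by omega
  funext t
  rw [telegraphTransform, h1, h2]

theorem telegraphTransform_even (ξ : ℝ) (k : ℕ) : telegraphTransform ξ (2 * k + 1 + 1) =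
    expMonomialConv (ξ * Complex.I) (-(ξ * Complex.I)) (k + 1) k := by
  have h1 : (2 * k + 1 + 1) / 2 = k + 1 := by omega
  have h2 : (2 * k + 1) / 2 = k := by omega
  funext t
  rw [telegraphTransform, h1, h2]

/-- The last reversal determines the current direction, so the parity of the index decides which
factor of the convolution loses a power: the second for an odd index, the first (after commuting)
for an even one. -/
theorem hasDerivAt_telegraphTransform_succ (ξ : ℝ) (n : ℕ) (t : ℝ) :
    HasDerivAt (telegraphTransform ξ (n + 1))
      ((-1) ^ (n + 1) * (ξ * Complex.I) * telegraphTransform ξ (n + 1) t +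
        telegraphTransform ξ n t) t := by
  obtain ⟨k, rfl | rfl⟩ := Nat.even_or_odd' n
  · have h3 : (-1 : ℂ) ^ (2 * k + 1) = -1 := by simp [pow_succ, pow_mul]
    rw [telegraphTransform_odd, h3, neg_one_mul]
    cases k with
    | zero =>
      have h : telegraphTransform ξ (2 * 0) t = expMonomial (ξ * Complex.I) 0 t := by
        simp [telegraphTransform, expMonomial]
      rw [h]
      exact hasDerivAt_expMonomialConv_zero _ _ _ t
    | succ j =>
      have h : telegraphTransform ξ (2 * (j + 1)) t = _ :=
        congrFun (telegraphTransform_even ξ j) t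
      rw [h]
      exact hasDerivAt_expMonomialConv_succ _ _ _ _ t
  · have h3 : (-1 : ℂ) ^ (2 * k + 1 + 1) = 1 := by simp [pow_succ, pow_mul]
    rw [telegraphTransform_even, telegraphTransform_odd, h3, one_mul,
      funext (expMonomialConv_comm _ _ (k + 1) k),
      expMonomialConv_comm _ _ k k]
    exact hasDerivAt_expMonomialConv_succ _ _ _ _ t

theorem telegraphTransform_succ_at_zero (ξ : ℝ) (n : ℕ) : telegraphTransform ξ (n + 1) 0 = 0 := by
  simp [telegraphTransform, expMonomialConv]

/-! ### Linear equations with right derivatives -/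

/-- A one-step expansion with quadratic error gives a right derivative. -/
theorem hasDerivWithinAt_of_norm_step_le {f g : ℝ → ℂ} {a b l : ℂ} {C t : ℝ}
    (h : ∀ s, 0 ≤ s → ‖f (t + s) - Complex.exp (a * s) * f t
      - l * s * Complex.exp (b * s) * g t‖ ≤ C * s ^ 2) :
    HasDerivWithinAt f (a * f t + l * g t) (Set.Ici t) t := by
  set r : ℝ → ℂ := fun x => f x - Complex.exp (a * ((x - t : ℝ) : ℂ)) * f t
      - l * ((x - t : ℝ) : ℂ) * Complex.exp (b * ((x - t : ℝ) : ℂ)) * g t with hr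
  have hrO : r =O[nhdsWithin t (Set.Ici t)] fun x => ‖x - t‖ ^ 2 := by
    refine Asymptotics.IsBigO.of_bound C ?_
    filter_upwards [self_mem_nhdsWithin] with x hx
    have hx : t ≤ x := hx
    have := h (x - t) (by linarith)
    rw [add_sub_cancel] at this
    simpa [hr] using this
  have h1 : HasDerivWithinAt r 0 (Set.Ici t) t := by
    have := (hrO.hasFDerivWithinAt (𝕜 := ℝ) Set.self_mem_Ici one_lt_two).hasDerivWithinAt
    simpa using this
  have hs : HasDerivAt (fun x : ℝ => ((x - t : ℝ) : ℂ)) 1 t := by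
    have := ((hasDerivAt_id t).sub_const t).ofReal_comp
    simpa using this
  have h2 : HasDerivAt (fun x : ℝ => Complex.exp (a * ((x - t : ℝ) : ℂ)) * f t
      + l * ((x - t : ℝ) : ℂ) * Complex.exp (b * ((x - t : ℝ) : ℂ)) * g t)
      (a * f t + l * g t) t := by
    refine ((((hs.const_mul a).cexp).mul_const (f t)).add
      (((hs.const_mul l).mul ((hs.const_mul b).cexp)).mul_const (g t))).congr_deriv ?_
    simp
  have h3 := h1.add h2.hasDerivWithinAt
  rw [zero_add] at h3
  refine h3.congr (fun x _ => ?_) ?_ <;> simp only [hr, Pi.add_apply] <;> ring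

/-- Uniqueness for a scalar linear equation with right derivatives. -/
theorem eq_of_hasDerivWithinAt_linear {f₁ f₂ g : ℝ → ℂ} {a : ℂ}
    (hc₁ : ContinuousOn f₁ (Set.Ici 0)) (hc₂ : ContinuousOn f₂ (Set.Ici 0))
    (h₁ : ∀ t, 0 ≤ t → HasDerivWithinAt f₁ (a * f₁ t + g t) (Set.Ici t) t)
    (h₂ : ∀ t, 0 ≤ t → HasDerivWithinAt f₂ (a * f₂ t + g t) (Set.Ici t) t)
    (h0 : f₁ 0 = f₂ 0) {t : ℝ} (ht : 0 ≤ t) : f₁ t = f₂ t := by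
  set d : ℝ → ℂ := fun x => Complex.exp (-a * x) * (f₁ x - f₂ x) with hd
  have hdc : ContinuousOn d (Set.Icc 0 t) := by
    have : ContinuousOn (fun x : ℝ => Complex.exp (-a * x)) (Set.Icc 0 t) :=
      (by fun_prop : Continuous fun x : ℝ => Complex.exp (-a * x)).continuousOn
    exact this.mul ((hc₁.sub hc₂).mono Set.Icc_subset_Ici_self)
  have hdd : ∀ x ∈ Set.Ico 0 t, HasDerivWithinAt d 0 (Set.Ici x) x := by
    intro x hx
    have he : HasDerivAt (fun t : ℝ => Complex.exp (-a * t)) (Complex.exp (-a * x) * (-a * 1)) x :=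
      ((Complex.ofRealCLM.hasDerivAt (x := x)).const_mul (-a)).cexp
    refine (he.hasDerivWithinAt.mul ((h₁ x hx.1).sub (h₂ x hx.1))).congr_deriv ?_
    simp only [Pi.sub_apply]
    ring
  have := constant_of_has_deriv_right_zero hdc hdd t ⟨ht, le_rfl⟩
  simp only [hd, h0, sub_self, mul_zero] at this
  rcases mul_eq_zero.1 this with h | h
  · exact absurd h (Complex.exp_ne_zero _)
  · exact sub_eq_zero.1 h

/-! ### Signed time and its Riemann sums -/

/-- The integral up to time `t` of the sign `(-1) ^ n s`. -/
noncomputable def signedTime (n : ℝ≥0 → ℕ) (t : ℝ≥0) : ℝ :=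
  ∫ s in (0 : ℝ)..t, (-1 : ℝ) ^ n s.toNNReal

/-- The Riemann sum of `signedTime` with `m` equal steps. -/
noncomputable def signedTimeSum (n : ℝ≥0 → ℕ) (t : ℝ≥0) (m : ℕ) : ℝ :=
  ∑ j ∈ Finset.range m, ((t / m : ℝ≥0) : ℝ) * (-1) ^ n (j * (t / m))

theorem intervalIntegrable_neg_one_pow {n : ℝ≥0 → ℕ} (hn : Monotone n) (u v : ℝ) :
    IntervalIntegrable (fun s : ℝ => (-1 : ℝ) ^ n s.toNNReal) volume u v := by
  have hm : Measurable fun s : ℝ => (-1 : ℝ) ^ n s.toNNReal :=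
    (measurable_of_countable fun k : ℕ => (-1 : ℝ) ^ k).comp
      (hn.measurable.comp measurable_real_toNNReal)
  refine (intervalIntegrable_const (c := (1 : ℝ))).mono_fun hm.aestronglyMeasurable ?_
  exact Filter.Eventually.of_forall fun s => by simp

theorem signedTime_add {n : ℝ≥0 → ℕ} (hn : Monotone n) (u v : ℝ≥0) :
    signedTime n v = signedTime n u + ∫ s in (u : ℝ)..v, (-1 : ℝ) ^ n s.toNNReal :=
  (intervalIntegral.integral_add_adjacent_intervals (intervalIntegrable_neg_one_pow hn _ _)
    (intervalIntegrable_neg_one_pow hn _ _)).symm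

theorem integral_neg_one_pow_of_eq {n : ℝ≥0 → ℕ} (hn : Monotone n) {u v : ℝ≥0} (huv : u ≤ v)
    (h : n u = n v) :
    ∫ s in (u : ℝ)..v, (-1 : ℝ) ^ n s.toNNReal = (v - u) * (-1) ^ n u := by
  have : ∫ s in (u : ℝ)..v, (-1 : ℝ) ^ n s.toNNReal = ∫ _ in (u : ℝ)..v, (-1 : ℝ) ^ n u := by
    refine intervalIntegral.integral_congr fun s hs => ?_
    rw [Set.uIcc_of_le (by exact_mod_cast huv)] at hs
    have h1 : n u ≤ n s.toNNReal := hn (NNReal.le_toNNReal_of_coe_le hs.1)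
    have h2 : n s.toNNReal ≤ n v := hn (Real.toNNReal_le_iff_le_coe.2 hs.2)
    rw [show n s.toNNReal = n u by omega]
  rw [this]
  simp

theorem abs_integral_neg_one_pow_le (n : ℝ≥0 → ℕ) {u v : ℝ≥0} (huv : u ≤ v) :
    |∫ s in (u : ℝ)..v, (-1 : ℝ) ^ n s.toNNReal| ≤ v - u := by
  have := intervalIntegral.norm_integral_le_of_norm_le_const (a := (u : ℝ)) (b := v) (C := 1)
    (f := fun s : ℝ => (-1 : ℝ) ^ n s.toNNReal) (fun s _ => by simp)
  have h : (0 : ℝ) ≤ v - u := sub_nonneg.2 (by exact_mod_cast huv)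
  rwa [one_mul, abs_of_nonneg h, Real.norm_eq_abs] at this

/-- Since `n` takes integer values, either it does not jump and the error is zero, or `n v - n u ≥
1` and the trivial bound `2 (v - u)` suffices. A bound by the increment of `n` telescopes over a
grid. -/
theorem abs_integral_neg_one_pow_sub_le {n : ℝ≥0 → ℕ} (hn : Monotone n) {u v : ℝ≥0}
    (huv : u ≤ v) :
    |(∫ s in (u : ℝ)..v, (-1 : ℝ) ^ n s.toNNReal) - (v - u) * (-1) ^ n u| ≤
      2 * (v - u) * ((n v : ℝ) - n u) := by
  have h : (0 : ℝ) ≤ v - u := sub_nonneg.2 (by exact_mod_cast huv)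
  rcases (hn huv).eq_or_lt with he | hlt
  · rw [integral_neg_one_pow_of_eq hn huv he, he]
    simp
  · have h1 : (1 : ℝ) ≤ (n v : ℝ) - n u := by
      have : (n u : ℝ) + 1 ≤ n v := by exact_mod_cast hlt
      linarith
    have h2 := abs_integral_neg_one_pow_le n huv
    have h3 : |((v : ℝ) - u) * (-1) ^ n u| = v - u := by
      rw [abs_mul, abs_of_nonneg h]; simp
    calc _ ≤ _ := abs_sub _ _
      _ ≤ 2 * ((v : ℝ) - u) * 1 := by rw [h3]; linarith
      _ ≤ _ := by gcongr

theorem abs_signedTime_sub_sum_le {n : ℝ≥0 → ℕ} (hn : Monotone n) (d : ℝ≥0) (m : ℕ) :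
    |signedTime n (m * d) - ∑ j ∈ Finset.range m, (d : ℝ) * (-1) ^ n (j * d)| ≤
      2 * d * ((n (m * d) : ℝ) - n 0) := by
  induction m with
  | zero => simp [signedTime]
  | succ m ih =>
    have hle : (m : ℝ≥0) * d ≤ ((m + 1 : ℕ) : ℝ≥0) * d := by gcongr; simp
    have hd : ((((m + 1 : ℕ) : ℝ≥0) * d : ℝ≥0) : ℝ) - ((m : ℝ≥0) * d : ℝ≥0) = d := by
      push_cast; ring
    have h2 := abs_integral_neg_one_pow_sub_le hn hle
    rw [hd] at h2
    rw [signedTime_add hn (m * d), Finset.sum_range_succ]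
    refine le_trans (le_of_eq ?_) ((abs_add_le _ _).trans ((add_le_add ih h2).trans (le_of_eq ?_)))
    · congr 1; ring
    · ring

theorem tendsto_signedTimeSum {n : ℝ≥0 → ℕ} (hn : Monotone n) (t : ℝ≥0) :
    Filter.Tendsto (signedTimeSum n t) Filter.atTop (nhds (signedTime n t)) := by
  rw [tendsto_iff_dist_tendsto_zero]
  have hlim : Filter.Tendsto (fun m : ℕ => 2 * (t : ℝ) * ((n t : ℝ) - n 0) / (m : ℝ))
      Filter.atTop (nhds 0) := tendsto_const_div_atTop_nhds_zero_nat _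
  refine squeeze_zero' (Filter.Eventually.of_forall fun _ => dist_nonneg) ?_ hlim
  filter_upwards [Filter.eventually_gt_atTop 0] with m hm
  have hm' : (m : ℝ≥0) ≠ 0 := by exact_mod_cast hm.ne'
  have := abs_signedTime_sub_sum_le hn (t / m) m
  rw [mul_div_cancel₀ t hm'] at this
  rw [dist_comm, Real.dist_eq]
  refine this.trans (le_of_eq ?_)
  push_cast
  ring

/-! ### Characters of the real line -/

/-- The characters `x ↦ exp (i ξ x)`. -/
noncomputable def realChar (ξ x : ℝ) : ℂ := Complex.exp (ξ * x * Complex.I)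

theorem continuous_realChar (ξ : ℝ) : Continuous (realChar ξ) := by
  unfold realChar
  fun_prop

theorem norm_realChar (ξ x : ℝ) : ‖realChar ξ x‖ = 1 := by
  unfold realChar
  exact_mod_cast Complex.norm_exp_ofReal_mul_I (ξ * x)

theorem realChar_add (ξ x y : ℝ) : realChar ξ (x + y) = realChar ξ x * realChar ξ y := by
  unfold realChar
  rw [← Complex.exp_add]
  push_cast
  ring_nf

theorem norm_realChar_sub_one_le (ξ x : ℝ) : ‖realChar ξ x - 1‖ ≤ |ξ| * |x| := by
  have := Real.norm_exp_I_mul_ofReal_sub_one_le (x := ξ * x)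
  rw [Real.norm_eq_abs, abs_mul] at this
  unfold realChar
  convert this using 4
  push_cast
  ring

/-! ### Independence of past and increment; pathwise one-step estimates -/

section
variable {Ω : Type*} [MeasurableSpace Ω] {P : Measure Ω} {N : ℝ≥0 → Ω → ℕ} {lam : ℝ≥0}

theorem measurable_signedTimeSum (hN : ∀ t, Measurable (N t)) (t : ℝ≥0) (m : ℕ) :
    Measurable fun ω => signedTimeSum (fun s => N s ω) t m := by
  unfold signedTimeSum
  refine Finset.measurable_sum _ fun j _ => Measurable.const_mul ?_ _
  exact (measurable_of_countable fun k : ℕ => (-1 : ℝ) ^ k).comp (hN _)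

theorem IsPoissonProcess.tendsto_signedTimeSum (hN : IsPoissonProcess N lam P) (t : ℝ≥0) :
    ∀ᵐ ω ∂P, Filter.Tendsto (signedTimeSum (fun s => N s ω) t) Filter.atTop
      (nhds (signedTime (fun s => N s ω) t)) := by
  filter_upwards [hN.monotone] with ω hω using _root_.tendsto_signedTimeSum hω t

theorem IsPoissonProcess.aemeasurable_signedTime (hN : IsPoissonProcess N lam P) (t : ℝ≥0) :
    AEMeasurable (fun ω => signedTime (fun s => N s ω) t) P :=
  aemeasurable_of_tendsto_metrizable_ae Filter.atTop
    (fun m => (measurable_signedTimeSum hN.measurable t m).aemeasurable)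
    (hN.tendsto_signedTimeSum t)

/-- The past of a Poisson process is independent of a later increment. -/
theorem IsPoissonProcess.indepFun_signedTimeSum (hN : IsPoissonProcess N lam P) (t h : ℝ≥0)
    {m : ℕ} (hm : m ≠ 0) :
    IndepFun (fun ω => (signedTimeSum (fun s => N s ω) t m, N t ω))
      (fun ω => N (t + h) ω - N t ω) P := by
  have hm' : (m : ℝ≥0) ≠ 0 := by exact_mod_cast hm
  -- The grid makes `m` equal steps up to `t`, then one step to `t + h`: the increments with index
  -- below `m` carry the past, the one with index `m` is the future.
  set τ : ℕ → ℝ≥0 := fun j => if j ≤ m then j * (t / m) else t + h with hτ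
  have hτm : τ m = t := by simp [hτ, mul_div_cancel₀ t hm']
  have hτm1 : τ (m + 1) = t + h := by simp [hτ]
  have hmono : Monotone τ := by
    refine monotone_nat_of_le_succ fun j => ?_
    by_cases h1 : j + 1 ≤ m
    · have h2 : j ≤ m := by omega
      simp only [hτ, h1, h2, if_true]
      gcongr
      simp
    · by_cases h2 : j ≤ m
      · have : j = m := by omega
        rw [this, hτm, hτm1]
        exact le_self_add
      · simp [hτ, h1, h2]
  have hind := (hN.indepIncrements.nat hmono).indepFun_finset (Finset.range m) {m} (by simp)
    (fun i => (hN.measurable _).sub (hN.measurable _))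
  -- `s j` recovers `N (j * (t / m))` from the increments; almost surely `N 0 = 0` and the path is
  -- monotone, so the truncated differences telescope.
  let s : ℕ → (Finset.range m → ℕ) → ℕ := fun j v =>
    ∑ i ∈ Finset.range j, if hi : i ∈ Finset.range m then v ⟨i, hi⟩ else 0
  let φ : (Finset.range m → ℕ) → ℝ × ℕ := fun v =>
    (∑ j ∈ Finset.range m, ((t / m : ℝ≥0) : ℝ) * (-1) ^ s j v, s m v)
  let ψ : (({m} : Finset ℕ) → ℕ) → ℕ := fun w => w ⟨m, by simp⟩
  have hφ : Measurable φ := measurable_of_countable φ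
  have hψ : Measurable ψ := measurable_of_countable ψ
  refine (hind.comp hφ hψ).congr ?_ ?_
  · filter_upwards [hN.monotone, hN.zero] with ω h1 h2
    have hs : ∀ j ≤ m, s j (fun i : Finset.range m => N (τ (i + 1)) ω - N (τ i) ω) =
        N (j * (t / m)) ω := by
      intro j hj
      have h3 : s j (fun i : Finset.range m => N (τ (i + 1)) ω - N (τ i) ω) =
          ∑ i ∈ Finset.range j, (N (τ (i + 1)) ω - N (τ i) ω) := by
        refine Finset.sum_congr rfl fun i hi => ?_
        have : i ∈ Finset.range m := by simp at hi ⊢; omega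
        rw [dif_pos this]
      have h0 : τ 0 = 0 := by simp [hτ]
      rw [h3, Finset.sum_range_tsub (f := fun i => N (τ i) ω) (h1.comp hmono), h0, h2]
      simp [hτ, hj]
    simp only [Function.comp_apply, φ, hs m le_rfl, mul_div_cancel₀ t hm', signedTimeSum]
    congr 1
    refine Finset.sum_congr rfl fun j hj => ?_
    rw [hs j (by simp at hj; omega)]
  · filter_upwards with ω
    simp [ψ, hτm, hτm1]

/-- The contribution at `ξ` of a path to the transform on the event that the count is in `S`. -/
noncomputable def charOn (ξ : ℝ) (S : Set ℕ) (n : ℝ≥0 → ℕ) (t : ℝ≥0) : ℂ :=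
  S.indicator (fun _ => realChar ξ (signedTime n t)) (n t)

theorem norm_charOn_le (ξ : ℝ) (S : Set ℕ) (n : ℝ≥0 → ℕ) (t : ℝ≥0) : ‖charOn ξ S n t‖ ≤ 1 :=
  (norm_indicator_le_norm_self _ _).trans (norm_realChar _ _).le

theorem aestronglyMeasurable_indicator_realChar {Y : Ω → ℝ} {M : Ω → ℕ} (hY : AEMeasurable Y P)
    (hM : Measurable M) (ξ : ℝ) (S : Set ℕ) :
    AEStronglyMeasurable (fun ω => S.indicator (fun _ => realChar ξ (Y ω)) (M ω)) P := by
  have h1 : AEStronglyMeasurable (fun ω => realChar ξ (Y ω)) P :=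
    ((continuous_realChar ξ).measurable.comp_aemeasurable hY).aestronglyMeasurable
  exact h1.indicator (hM (MeasurableSet.of_discrete (s := S)))

theorem IsPoissonProcess.integrable_charOn [IsFiniteMeasure P] (hN : IsPoissonProcess N lam P)
    (ξ : ℝ) (S : Set ℕ) (t : ℝ≥0) : Integrable (fun ω => charOn ξ S (fun s => N s ω) t) P :=
  Integrable.of_bound (aestronglyMeasurable_indicator_realChar (hN.aemeasurable_signedTime t)
    (hN.measurable t) ξ S) 1 (Filter.Eventually.of_forall fun _ => norm_charOn_le _ _ _ _)

/-- Independence is assumed only for the Riemann sums; the factorisation passes to the limit by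
dominated convergence with bound `1`. The variable `Z` is general because it serves both for a later
increment and for the initial direction. -/
theorem IsPoissonProcess.integral_indicator_mul_charOn [IsProbabilityMeasure P]
    (hN : IsPoissonProcess N lam P) {E : Type*} [MeasurableSpace E] {Z : Ω → E}
    (hZ : Measurable Z) (t : ℝ≥0)
    (hind : ∀ m : ℕ, m ≠ 0 →
      IndepFun (fun ω => (signedTimeSum (fun s => N s ω) t m, N t ω)) Z P)
    (ξ : ℝ) (S : Set ℕ) {A : Set E} (hA : MeasurableSet A) :
    ∫ ω, A.indicator (fun _ => (1 : ℂ)) (Z ω) * charOn ξ S (fun s => N s ω) t ∂P =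
      P.real (Z ⁻¹' A) * ∫ ω, charOn ξ S (fun s => N s ω) t ∂P := by
  set R : ℕ → Ω → ℂ := fun m ω =>
    S.indicator (fun _ => realChar ξ (signedTimeSum (fun s => N s ω) t m)) (N t ω) with hR
  have hRm : ∀ m, AEStronglyMeasurable (R m) P := fun m =>
    aestronglyMeasurable_indicator_realChar
      (measurable_signedTimeSum hN.measurable t m).aemeasurable (hN.measurable t) ξ S
  have hRb : ∀ m ω, ‖R m ω‖ ≤ 1 := fun m ω =>
    (norm_indicator_le_norm_self _ _).trans (norm_realChar _ _).le
  have hRt : ∀ᵐ ω ∂P, Filter.Tendsto (fun m => R m ω) Filter.atTop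
      (nhds (charOn ξ S (fun s => N s ω) t)) := by
    filter_upwards [hN.tendsto_signedTimeSum t] with ω hω
    by_cases h : N t ω ∈ S
    · simp only [hR, charOn, Set.indicator_of_mem h]
      exact ((continuous_realChar ξ).tendsto _).comp hω
    · simp [hR, charOn, Set.indicator_of_notMem h]
  have hIm : Measurable (A.indicator fun _ => (1 : ℂ)) := measurable_const.indicator hA
  have hIb : ∀ z, ‖A.indicator (fun _ => (1 : ℂ)) z‖ ≤ 1 := fun z =>
    (norm_indicator_le_norm_self _ _).trans (by simp)
  have l1 : Filter.Tendsto (fun m => ∫ ω, A.indicator (fun _ => (1 : ℂ)) (Z ω) * R m ω ∂P)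
      Filter.atTop
      (nhds (∫ ω, A.indicator (fun _ => (1 : ℂ)) (Z ω) * charOn ξ S (fun s => N s ω) t ∂P)) := by
    refine tendsto_integral_of_dominated_convergence (fun _ => (1 : ℝ))
      (fun m => (hIm.comp hZ).aestronglyMeasurable.mul (hRm m)) (integrable_const _)
      (fun m => Filter.Eventually.of_forall fun ω => ?_) ?_
    · rw [norm_mul]
      exact mul_le_one₀ (hIb _) (norm_nonneg _) (hRb m ω)
    · filter_upwards [hRt] with ω hω using hω.const_mul _
  have l2 : Filter.Tendsto (fun m => (P.real (Z ⁻¹' A) : ℂ) * ∫ ω, R m ω ∂P) Filter.atTop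
      (nhds (P.real (Z ⁻¹' A) * ∫ ω, charOn ξ S (fun s => N s ω) t ∂P)) := by
    refine Filter.Tendsto.const_mul _ ?_
    exact tendsto_integral_of_dominated_convergence (fun _ => (1 : ℝ)) hRm (integrable_const _)
      (fun m => Filter.Eventually.of_forall fun ω => hRb m ω) hRt
  refine tendsto_nhds_unique (l1.congr' ?_) l2
  filter_upwards [Filter.eventually_gt_atTop 0] with m hm
  have hS : Measurable fun p : ℝ × ℕ => S.indicator (fun _ => realChar ξ p.1) p.2 :=
    ((continuous_realChar ξ).measurable.comp measurable_fst).indicator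
      (measurable_snd (MeasurableSet.of_discrete (s := S)))
  have hi := ((hind m hm.ne').symm.comp hIm hS)
  have := hi.integral_fun_mul_eq_mul_integral (hIm.comp hZ).aestronglyMeasurable (hRm m)
  simp only [Function.comp_apply] at this
  rw [this]
  congr 1
  have h2 : (fun ω => A.indicator (fun _ => (1 : ℂ)) (Z ω)) =
      (Z ⁻¹' A).indicator fun _ => (1 : ℂ) := rfl
  rw [h2, integral_indicator (hZ hA)]
  simp

/-- Three cases for the increment. If it is `0`, the expansion is exact. If it is `1`, freezing the
signed time at `t` costs at most `|ξ| h`. If it is at least `2`, only the left-hand term survives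
and has norm at most `1`. Each error has expectation `O(h²)`. -/
theorem norm_charOn_sub_le {n : ℝ≥0 → ℕ} (hn : Monotone n) (ξ : ℝ) (k : ℕ) (t h : ℝ≥0) :
    ‖charOn ξ {k} n (t + h) -
      (({0} : Set ℕ).indicator (fun _ => (1 : ℂ)) (n (t + h) - n t) * charOn ξ {k} n t *
          realChar ξ ((-1) ^ k * h) +
        ({1} : Set ℕ).indicator (fun _ => (1 : ℂ)) (n (t + h) - n t) *
          charOn ξ {j | j + 1 = k} n t)‖ ≤
      |ξ| * h * (({0} : Set ℕ)ᶜ).indicator (fun _ => (1 : ℝ)) (n (t + h) - n t) +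
        (({0, 1} : Set ℕ)ᶜ).indicator (fun _ => (1 : ℝ)) (n (t + h) - n t) := by
  have hle : t ≤ t + h := le_self_add
  have hmono := hn hle
  have hcoe : (((t + h : ℝ≥0) : ℝ) - t) = h := by push_cast; ring
  have hY := signedTime_add hn t (t + h)
  generalize hΔ : n (t + h) - n t = Δ
  have hv : n (t + h) = n t + Δ := by omega
  rcases Δ with _ | _ | Δ
  · have h0 := integral_neg_one_pow_of_eq hn hle (by omega)
    rw [hcoe] at h0
    rw [h0] at hY
    simp only [charOn, hv, Nat.add_zero]
    by_cases hk : n t = k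
    · simp [hk, hY, realChar_add, mul_comm (h : ℝ)]
    · simp [hk]
  · have h1 := abs_integral_neg_one_pow_le n hle
    rw [hcoe] at h1
    simp only [charOn, hv, Nat.zero_add]
    by_cases hk : n t + 1 = k
    · have : ‖realChar ξ (signedTime n (t + h)) - realChar ξ (signedTime n t)‖ ≤ |ξ| * h := by
        rw [hY, realChar_add, ← mul_sub_one, norm_mul, norm_realChar, one_mul]
        exact (norm_realChar_sub_one_le _ _).trans (by gcongr)
      simpa [hk] using this
    · simp [hk]
      positivity
  · have h2 := norm_charOn_le ξ {k} n (t + h)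
    have h3 : 0 ≤ |ξ| * h := by positivity
    simp
    linarith

theorem norm_charOn_sub_charOn_le {n : ℝ≥0 → ℕ} (hn : Monotone n) (ξ : ℝ) (k : ℕ) (t h : ℝ≥0) :
    ‖charOn ξ {k} n (t + h) - charOn ξ {k} n t‖ ≤
      |ξ| * h + 2 * (({0} : Set ℕ)ᶜ).indicator (fun _ => (1 : ℝ)) (n (t + h) - n t) := by
  have hle : t ≤ t + h := le_self_add
  have hmono := hn hle
  have h3 : 0 ≤ |ξ| * h := by positivity
  by_cases he : n (t + h) = n t
  · have h1 := abs_integral_neg_one_pow_le n hle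
    have hcoe : (((t + h : ℝ≥0) : ℝ) - t) = h := by push_cast; ring
    rw [hcoe] at h1
    by_cases hk : n t = k
    · have : ‖realChar ξ (signedTime n (t + h)) - realChar ξ (signedTime n t)‖ ≤ |ξ| * h := by
        rw [signedTime_add hn t (t + h), realChar_add, ← mul_sub_one, norm_mul, norm_realChar,
          one_mul]
        exact (norm_realChar_sub_one_le _ _).trans (by gcongr)
      simpa [charOn, he, hk] using this
    · simp [charOn, he, hk, h3]
  · have h4 : n (t + h) - n t ∈ ({0} : Set ℕ)ᶜ := by simp; omega
    rw [Set.indicator_of_mem h4]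
    have h5 := norm_charOn_le ξ {k} n (t + h)
    have h6 := norm_charOn_le ξ {k} n t
    have h7 := norm_sub_le (charOn ξ {k} n (t + h)) (charOn ξ {k} n t)
    linarith

end

/-! ### The differential equations for the transforms of the process -/

section
variable {Ω : Type*} [MeasurableSpace Ω] {P : Measure Ω} {N : ℝ≥0 → Ω → ℕ} {lam : ℝ≥0}

theorem IsPoissonProcess.measureReal_increment (hN : IsPoissonProcess N lam P) (t h : ℝ≥0)
    (A : Set ℕ) :
    P.real ((fun ω => N (t + h) ω - N t ω) ⁻¹' A) = (poissonMeasure (lam * h)).real A := by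
  have := hN.law t (t + h) le_self_add
  rw [add_tsub_cancel_left] at this
  exact this.measureReal_eq (p := fun x => x ∈ A) MeasurableSet.of_discrete

theorem poissonMeasure_real_compl_zero_le (r : ℝ≥0) :
    (poissonMeasure r).real {0}ᶜ ≤ r := by
  rw [probReal_compl_eq_one_sub (MeasurableSet.of_discrete), poissonMeasure_real_singleton]
  have := Real.add_one_le_exp (-(r : ℝ))
  simp
  linarith

theorem poissonMeasure_real_compl_zero_one_le (r : ℝ≥0) :
    (poissonMeasure r).real {0, 1}ᶜ ≤ (r : ℝ) ^ 2 := by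
  have h01 : ({0, 1} : Set ℕ) = {0} ∪ {1} := rfl
  rw [probReal_compl_eq_one_sub (MeasurableSet.of_discrete), h01,
    measureReal_union (by simp) (MeasurableSet.of_discrete),
    poissonMeasure_real_singleton, poissonMeasure_real_singleton]
  have h1 := Real.add_one_le_exp (-(r : ℝ))
  have h2 : (0 : ℝ) ≤ r := r.2
  simp
  -- By `exp (-r) ≥ 1 - r`, the mass of `{0, 1}` is at least `(1 - r) (1 + r) = 1 - r²`.
  nlinarith

/-- The transform at `ξ` of the signed time at `t` on the event that the count is in `S`. -/
noncomputable def countTransform (P : Measure Ω) (N : ℝ≥0 → Ω → ℕ) (ξ : ℝ) (S : Set ℕ)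
    (t : ℝ≥0) : ℂ :=
  ∫ ω, charOn ξ S (fun s => N s ω) t ∂P

theorem integral_indicator_increment [IsFiniteMeasure P] (hN : IsPoissonProcess N lam P) (t h : ℝ≥0)
    (A : Set ℕ) :
    ∫ ω, A.indicator (fun _ => (1 : ℝ)) (N (t + h) ω - N t ω) ∂P =
      (poissonMeasure (lam * h)).real A := by
  rw [← hN.measureReal_increment t h A]
  have hm : Measurable fun ω => N (t + h) ω - N t ω := (hN.measurable _).sub (hN.measurable _)
  have h2 : (fun ω => A.indicator (fun _ => (1 : ℝ)) (N (t + h) ω - N t ω)) =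
      ((fun ω => N (t + h) ω - N t ω) ⁻¹' A).indicator fun _ => (1 : ℝ) := rfl
  rw [h2, integral_indicator (hm MeasurableSet.of_discrete)]
  simp

theorem integrable_indicator_increment [IsFiniteMeasure P] (hN : IsPoissonProcess N lam P)
    (t h : ℝ≥0) (A : Set ℕ) :
    Integrable (fun ω => A.indicator (fun _ => (1 : ℝ)) (N (t + h) ω - N t ω)) P := by
  have hm : Measurable fun ω => N (t + h) ω - N t ω := (hN.measurable _).sub (hN.measurable _)
  exact (integrable_const (1 : ℝ)).indicator (hm (MeasurableSet.of_discrete (s := A)))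

variable [IsProbabilityMeasure P]

theorem integrable_indicator_mul_charOn (hN : IsPoissonProcess N lam P) (t h : ℝ≥0) (ξ : ℝ)
    (A S : Set ℕ) :
    Integrable (fun ω => A.indicator (fun _ => (1 : ℂ)) (N (t + h) ω - N t ω) *
      charOn ξ S (fun s => N s ω) t) P := by
  have hm : Measurable fun ω => N (t + h) ω - N t ω := (hN.measurable _).sub (hN.measurable _)
  refine (hN.integrable_charOn ξ S t).bdd_mul (c := 1)
    ((measurable_const.indicator MeasurableSet.of_discrete).comp hm).aestronglyMeasurable ?_
  exact Filter.Eventually.of_forall fun ω => (norm_indicator_le_norm_self _ _).trans (by simp)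

/-- The expectation of `norm_charOn_sub_le`, with weights `exp (-λh)` and `λh exp (-λh)` for zero
and one event. The set `{j | j + 1 = k}` stands for the index `k - 1` and is empty for `k = 0`, so
that case needs no separate equation. -/
theorem norm_countTransform_step_le (hN : IsPoissonProcess N lam P) (ξ : ℝ) (k : ℕ) (t h : ℝ≥0) :
    ‖countTransform P N ξ {k} (t + h)
        - Complex.exp ((-lam + (-1) ^ k * (ξ * Complex.I)) * (h : ℝ)) * countTransform P N ξ {k} t
        - lam * (h : ℝ) * Complex.exp (-lam * (h : ℝ)) *
          countTransform P N ξ {j | j + 1 = k} t‖ ≤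
      (|ξ| * lam + lam ^ 2) * (h : ℝ) ^ 2 := by
  have hm : Measurable fun ω => N (t + h) ω - N t ω := (hN.measurable _).sub (hN.measurable _)
  have hI := fun (S A : Set ℕ) => hN.integral_indicator_mul_charOn hm t
    (fun m hm' => hN.indepFun_signedTimeSum t h hm') ξ S (A := A) MeasurableSet.of_discrete
  have i1 := hN.integrable_charOn ξ {k} (t + h)
  have i2 := (integrable_indicator_mul_charOn hN t h ξ {0} {k}).mul_const
    (realChar ξ ((-1) ^ k * h))
  have i3 := integrable_indicator_mul_charOn hN t h ξ {1} {j | j + 1 = k}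
  have hint := integral_sub i1 (i2.add i3)
  have hadd := integral_add i2 i3
  simp only [Pi.add_apply] at hint
  rw [hadd, integral_mul_const, hI, hI, hN.measureReal_increment,
    hN.measureReal_increment, poissonMeasure_real_singleton, poissonMeasure_real_singleton] at hint
  have e1 : Complex.exp ((-lam + (-1) ^ k * (ξ * Complex.I)) * (h : ℝ)) =
      Complex.exp (-lam * (h : ℝ)) * realChar ξ ((-1) ^ k * h) := by
    unfold realChar
    rw [← Complex.exp_add]
    congr 1
    push_cast
    ring
  refine (le_of_eq (congrArg norm (Eq.trans ?_ hint.symm))).trans ?_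
  · rw [e1]
    unfold countTransform
    push_cast
    simp
    ring
  refine (norm_integral_le_of_norm_le (((integrable_indicator_increment hN t h ({0}ᶜ)).const_mul
    (|ξ| * h)).add (integrable_indicator_increment hN t h ({0, 1}ᶜ))) ?_).trans ?_
  · filter_upwards [hN.monotone] with ω hω using norm_charOn_sub_le hω ξ k t h
  · simp only [Pi.add_apply]
    rw [integral_add ((integrable_indicator_increment hN t h ({0}ᶜ)).const_mul _)
      (integrable_indicator_increment hN t h ({0, 1}ᶜ)), integral_const_mul,
      integral_indicator_increment hN, integral_indicator_increment hN]
    have h1 := poissonMeasure_real_compl_zero_le (lam * h)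
    have h2 := poissonMeasure_real_compl_zero_one_le (lam * h)
    have h3 : |ξ| * h * (poissonMeasure (lam * h)).real {0}ᶜ ≤ |ξ| * h * (lam * h : ℝ≥0) := by
      gcongr
    push_cast at h2 h3
    calc _ ≤ _ := add_le_add h3 h2
      _ = _ := by ring

/-- Right derivatives alone do not control left limits; this Lipschitz bound supplies the continuity
that the uniqueness lemma requires. -/
theorem norm_countTransform_sub_le (hN : IsPoissonProcess N lam P) (ξ : ℝ) (k : ℕ) (t h : ℝ≥0) :
    ‖countTransform P N ξ {k} (t + h) - countTransform P N ξ {k} t‖ ≤ (|ξ| + 2 * lam) * h := by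
  unfold countTransform
  rw [← integral_sub (hN.integrable_charOn ξ {k} (t + h)) (hN.integrable_charOn ξ {k} t)]
  refine (norm_integral_le_of_norm_le ((integrable_const (|ξ| * (h : ℝ))).add
    ((integrable_indicator_increment hN t h ({0}ᶜ)).const_mul 2)) ?_).trans ?_
  · filter_upwards [hN.monotone] with ω hω using norm_charOn_sub_charOn_le hω ξ k t h
  · simp only [Pi.add_apply]
    rw [integral_add (integrable_const _)
      ((integrable_indicator_increment hN t h ({0}ᶜ)).const_mul _), integral_const,
      integral_const_mul, integral_indicator_increment hN]
    have h1 := poissonMeasure_real_compl_zero_le (lam * h)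
    push_cast at h1
    simp
    linarith

theorem continuousOn_countTransform (hN : IsPoissonProcess N lam P) (ξ : ℝ) (k : ℕ) :
    ContinuousOn (fun t : ℝ => countTransform P N ξ {k} t.toNNReal) (Set.Ici 0) := by
  have key : ∀ x y : ℝ, 0 ≤ x → x ≤ y → dist (countTransform P N ξ {k} y.toNNReal)
      (countTransform P N ξ {k} x.toNNReal) ≤ (|ξ| + 2 * lam) * dist y x := by
    intro x y hx hxy
    have := norm_countTransform_sub_le hN ξ k x.toNNReal (y - x).toNNReal
    rw [← Real.toNNReal_add hx (by linarith), add_sub_cancel, Real.coe_toNNReal _ (by linarith)]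
      at this
    rwa [Real.dist_eq, abs_of_nonneg (a := y - x) (by linarith), dist_eq_norm]
  have : LipschitzOnWith (|ξ| + 2 * lam).toNNReal
      (fun t : ℝ => countTransform P N ξ {k} t.toNNReal) (Set.Ici 0) := by
    refine LipschitzOnWith.of_dist_le_mul fun x hx y hy => ?_
    rw [Real.coe_toNNReal _ (by positivity)]
    rcases le_total x y with h | h
    · rw [dist_comm, dist_comm x y]
      exact key x y hx h
    · exact key y x hy h
  exact this.continuousOn

theorem countTransform_at_zero (hN : IsPoissonProcess N lam P) (ξ : ℝ) (k : ℕ) :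
    countTransform P N ξ {k} 0 = if k = 0 then 1 else 0 := by
  have : countTransform P N ξ {k} 0 = ∫ _, (if k = 0 then 1 else 0 : ℂ) ∂P := by
    refine integral_congr_ae ?_
    filter_upwards [hN.zero] with ω hω
    by_cases hk : k = 0
    · simp [charOn, hω, hk, signedTime, realChar]
    · simp [charOn, hω, hk, Ne.symm hk]
  rw [this]
  simp

theorem hasDerivWithinAt_countTransform (hN : IsPoissonProcess N lam P) (ξ : ℝ) (k : ℕ) {t : ℝ}
    (ht : 0 ≤ t) :
    HasDerivWithinAt (fun t : ℝ => countTransform P N ξ {k} t.toNNReal)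
      ((-lam + (-1) ^ k * (ξ * Complex.I)) * countTransform P N ξ {k} t.toNNReal +
        lam * countTransform P N ξ {j | j + 1 = k} t.toNNReal) (Set.Ici t) t := by
  refine hasDerivWithinAt_of_norm_step_le (b := -lam) (C := |ξ| * lam + lam ^ 2)
    (g := fun t : ℝ => countTransform P N ξ {j | j + 1 = k} t.toNNReal) fun s hs => ?_
  have := norm_countTransform_step_le hN ξ k t.toNNReal s.toNNReal
  rwa [← Real.toNNReal_add ht hs, Real.coe_toNNReal _ hs] at this

/-- The system is triangular: once the transform for `k` is known, the one for `k + 1` solves a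
scalar linear equation with known source and initial value `0`. -/
theorem countTransform_eq (hN : IsPoissonProcess N lam P) (ξ : ℝ) (k : ℕ) {t : ℝ} (ht : 0 ≤ t) :
    countTransform P N ξ {k} t.toNNReal =
      Complex.exp (-lam * t) * lam ^ k * telegraphTransform ξ k t := by
  have he : ∀ t : ℝ, HasDerivAt (fun t : ℝ => Complex.exp (-lam * t))
      (Complex.exp (-lam * t) * (-lam * 1)) t := fun t =>
    ((Complex.ofRealCLM.hasDerivAt (x := t)).const_mul (-(lam : ℂ))).cexp
  induction k generalizing t with
  | zero =>
    have h2 : ∀ t : ℝ, HasDerivAt (fun t : ℝ => Complex.exp (-lam * t) * lam ^ 0 *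
        telegraphTransform ξ 0 t) ((-lam + (-1) ^ 0 * (ξ * Complex.I)) *
        (Complex.exp (-lam * t) * lam ^ 0 * telegraphTransform ξ 0 t) + 0) t := fun t => by
      refine (((he t).mul_const _).mul (hasDerivAt_telegraphTransform_zero ξ t)).congr_deriv ?_
      ring
    refine eq_of_hasDerivWithinAt_linear (continuousOn_countTransform hN ξ 0)
      (fun t _ => (h2 t).continuousAt.continuousWithinAt) (g := fun _ => 0) (fun t ht => ?_)
      (fun t _ => (h2 t).hasDerivWithinAt) ?_ ht
    · refine (hasDerivWithinAt_countTransform hN ξ 0 ht).congr_deriv ?_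
      simp [countTransform, charOn]
    · simp [countTransform_at_zero hN, telegraphTransform]
  | succ k ih =>
    have h2 : ∀ t : ℝ, HasDerivAt (fun t : ℝ => Complex.exp (-lam * t) * lam ^ (k + 1) *
        telegraphTransform ξ (k + 1) t) ((-lam + (-1) ^ (k + 1) * (ξ * Complex.I)) *
        (Complex.exp (-lam * t) * lam ^ (k + 1) * telegraphTransform ξ (k + 1) t) +
        lam * (Complex.exp (-lam * t) * lam ^ k * telegraphTransform ξ k t)) t := fun t => by
      refine (((he t).mul_const _).mul (hasDerivAt_telegraphTransform_succ ξ k t)).congr_deriv ?_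
      ring
    refine eq_of_hasDerivWithinAt_linear (continuousOn_countTransform hN ξ (k + 1))
      (fun t _ => (h2 t).continuousAt.continuousWithinAt)
      (g := fun t => lam * (Complex.exp (-lam * t) * lam ^ k * telegraphTransform ξ k t))
      (fun t ht => ?_) (fun t _ => (h2 t).hasDerivWithinAt) ?_ ht
    · refine (hasDerivWithinAt_countTransform hN ξ (k + 1) ht).congr_deriv ?_
      have : {j : ℕ | j + 1 = k + 1} = {k} := by ext; simp
      rw [this, ih ht]
    · simp [countTransform_at_zero hN, telegraphTransform_succ_at_zero]

end

/-! ### Densities on the events of a given number of reversals -/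

section
variable {Ω : Type*} [MeasurableSpace Ω] {P : Measure Ω} {N : ℝ≥0 → Ω → ℕ} {lam : ℝ≥0}

/-- The density, in the time `y` spent moving in the initial direction up to time `t`, of the law
of a telegraph process on the event of `n + 1` reversals. -/
noncomputable def reversalDensity (lam : ℝ) (n : ℕ) (t y : ℝ) : ℝ :=
  Real.exp (-lam * t) * lam ^ (n + 1) *
    (y ^ ((n + 1) / 2) / ((n + 1) / 2).factorial * ((t - y) ^ (n / 2) / (n / 2).factorial))

theorem continuous_reversalDensity (lam : ℝ) (n : ℕ) (t : ℝ) :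
    Continuous (reversalDensity lam n t) := by
  unfold reversalDensity
  fun_prop

theorem reversalDensity_nonneg {lam : ℝ} (hlam : 0 ≤ lam) (n : ℕ) {t y : ℝ} (hy : 0 ≤ y)
    (hyt : y ≤ t) : 0 ≤ reversalDensity lam n t y := by
  have := sub_nonneg.2 hyt
  unfold reversalDensity
  positivity

theorem integral_reversalDensity_mul_realChar (lam : ℝ) (n : ℕ) (ξ t : ℝ) :
    ∫ y in (0 : ℝ)..t, (reversalDensity lam n t y : ℂ) * realChar ξ (2 * y - t) =
      Complex.exp (-lam * t) * lam ^ (n + 1) * telegraphTransform ξ (n + 1) t := by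
  rw [telegraphTransform, expMonomialConv, ← intervalIntegral.integral_const_mul]
  congr 1
  ext y
  have : realChar ξ (2 * y - t) = Complex.exp (ξ * Complex.I * y) *
      Complex.exp (-(ξ * Complex.I) * ((t - y : ℝ) : ℂ)) := by
    unfold realChar
    rw [← Complex.exp_add]
    congr 1
    push_cast
    ring
  rw [this]
  unfold reversalDensity expMonomial
  push_cast
  ring

variable [IsProbabilityMeasure P]

/-- Both sides are finite measures, so it is enough to compare characteristic functions.
Independence of `D` splits off the factor `p`; the rest is `countTransform_eq` read as a Fourier
integral. -/
theorem IsPoissonProcess.map_restrict_signedTime (hN : IsPoissonProcess N lam P) {D : Ω → ℝ}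
    (hD : Measurable D) (hind : IndepFun D (fun ω t => N t ω) P) (d : ℝ) (n : ℕ) (t : ℝ≥0) :
    (P.restrict (N t ⁻¹' {n + 1} ∩ D ⁻¹' {d})).map (fun ω => signedTime (fun s => N s ω) t) =
      ((volume.restrict (Set.Ioc 0 (t : ℝ))).withDensity fun y =>
        ENNReal.ofReal (P.real (D ⁻¹' {d}) * reversalDensity lam n t y)).map
          fun y => 2 * y - (t : ℝ) := by
  set p := P.real (D ⁻¹' {d}) with hp
  have hms : MeasurableSet (N t ⁻¹' {n + 1} ∩ D ⁻¹' {d}) :=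
    ((hN.measurable t) (measurableSet_singleton _)).inter (hD (measurableSet_singleton _))
  have hY := (hN.aemeasurable_signedTime t).mono_measure
    (Measure.restrict_le_self (s := N t ⁻¹' {n + 1} ∩ D ⁻¹' {d}))
  have hc : Continuous fun y : ℝ => p * reversalDensity lam n t y :=
    continuous_const.mul (continuous_reversalDensity lam n t)
  have hpos : ∀ y ∈ Set.Ioc 0 (t : ℝ), 0 ≤ p * reversalDensity lam n t y := fun y hy =>
    mul_nonneg measureReal_nonneg (reversalDensity_nonneg lam.2 n hy.1.le hy.2)
  have hfin : IsFiniteMeasure ((volume.restrict (Set.Ioc 0 (t : ℝ))).withDensity fun y =>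
      ENNReal.ofReal (p * reversalDensity lam n t y)) :=
    isFiniteMeasure_withDensity_ofReal
      ((hc.integrableOn_Icc (a := 0) (b := (t : ℝ))).mono_set Set.Ioc_subset_Icc_self).2
  refine Measure.ext_of_charFun (funext fun ξ => ?_)
  have hch : Measurable fun x : ℝ => Complex.exp (ξ * x * Complex.I) :=
    (continuous_realChar ξ).measurable
  rw [charFun_apply_real, charFun_apply_real, integral_map hY hch.aestronglyMeasurable,
    integral_map (by fun_prop) hch.aestronglyMeasurable,
    integral_withDensity_eq_integral_toReal_smul hc.measurable.ennreal_ofReal (by simp)]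
  have hind' : ∀ m : ℕ, m ≠ 0 →
      IndepFun (fun ω => (signedTimeSum (fun s => N s ω) t m, N t ω)) D P := by
    intro m _
    have hm : Measurable fun n : ℝ≥0 → ℕ => (signedTimeSum n t m, n t) :=
      (measurable_signedTimeSum (N := fun s (n : ℝ≥0 → ℕ) => n s)
        (fun s => measurable_pi_apply s) t m).prodMk (measurable_pi_apply t)
    exact (hind.comp measurable_id hm).symm
  have h1 := hN.integral_indicator_mul_charOn hD t hind' ξ {n + 1} (measurableSet_singleton d)
  have h2 := countTransform_eq hN ξ (n + 1) t.2
  have h3 := integral_reversalDensity_mul_realChar lam n ξ t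
  have h4 : (t : ℝ).toNNReal = t := Real.toNNReal_coe
  change countTransform P N ξ {n + 1} (t : ℝ).toNNReal = _ at h2
  rw [h4] at h2
  change _ = _ * countTransform P N ξ {n + 1} t at h1
  rw [h2] at h1
  trans (p : ℂ) * (Complex.exp (-lam * (t : ℝ)) * lam ^ (n + 1) * telegraphTransform ξ (n + 1) t)
  · refine Eq.trans ?_ h1
    rw [← integral_indicator hms]
    refine integral_congr_ae (Filter.Eventually.of_forall fun ω => ?_)
    by_cases h5 : N t ω = n + 1 <;> by_cases h6 : D ω = d <;>
      simp [charOn, h5, h6, Set.indicator, realChar]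
  · rw [← h3, intervalIntegral.integral_of_le t.coe_nonneg, ← integral_const_mul]
    refine setIntegral_congr_fun measurableSet_Ioc fun y hy => ?_
    rw [ENNReal.toReal_ofReal (hpos y hy)]
    simp [realChar]
    ring

theorem IsPoissonProcess.measureReal_signedTime_mem_Ioo (hN : IsPoissonProcess N lam P) {D : Ω → ℝ}
    (hD : Measurable D) (hind : IndepFun D (fun ω t => N t ω) P) (d : ℝ) (n : ℕ) (t : ℝ≥0)
    {u v : ℝ} (hu : -(t : ℝ) ≤ u) (huv : u ≤ v) (hv : v ≤ t) :
    P.real ((fun ω => signedTime (fun s => N s ω) t) ⁻¹' Set.Ioo u v ∩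
        (N t ⁻¹' {n + 1} ∩ D ⁻¹' {d})) =
      P.real (D ⁻¹' {d}) * ((1 / 2) * ∫ x in u..v, reversalDensity lam n t ((t + x) / 2)) := by
  set p := P.real (D ⁻¹' {d}) with hp
  have hms : MeasurableSet (N t ⁻¹' {n + 1} ∩ D ⁻¹' {d}) :=
    ((hN.measurable t) (measurableSet_singleton _)).inter (hD (measurableSet_singleton _))
  have hY := (hN.aemeasurable_signedTime t).mono_measure
    (Measure.restrict_le_self (s := N t ⁻¹' {n + 1} ∩ D ⁻¹' {d}))
  have hc : Continuous fun y : ℝ => p * reversalDensity lam n t y :=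
    continuous_const.mul (continuous_reversalDensity lam n t)
  have hset : (fun y : ℝ => 2 * y - (t : ℝ)) ⁻¹' Set.Ioo u v = Set.Ioo ((t + u) / 2) ((t + v) / 2) := by
    ext y
    simp only [Set.mem_preimage, Set.mem_Ioo]
    constructor <;> rintro ⟨h1, h2⟩ <;> constructor <;> linarith
  have hsub : Set.Ioo (((t : ℝ) + u) / 2) ((t + v) / 2) ⊆ Set.Ioc 0 (t : ℝ) := fun y hy =>
    ⟨by have := hy.1; linarith, by have := hy.2; linarith⟩
  have hpos : ∀ y ∈ Set.Ioo (((t : ℝ) + u) / 2) ((t + v) / 2), 0 ≤ p * reversalDensity lam n t y :=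
    fun y hy => mul_nonneg measureReal_nonneg
      (reversalDensity_nonneg lam.2 n (hsub hy).1.le (hsub hy).2)
  have h1 := congrArg (fun μ : Measure ℝ => μ (Set.Ioo u v))
    (hN.map_restrict_signedTime hD hind d n t)
  rw [Measure.map_apply_of_aemeasurable hY measurableSet_Ioo, Measure.restrict_apply' hms,
    Measure.map_apply (by fun_prop) measurableSet_Ioo, hset,
    withDensity_apply _ measurableSet_Ioo, Measure.restrict_restrict measurableSet_Ioo,
    Set.inter_eq_left.2 hsub] at h1
  rw [measureReal_def, h1, ← integral_eq_lintegral_of_nonneg_ae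
    (ae_restrict_of_forall_mem measurableSet_Ioo hpos) hc.aestronglyMeasurable,
    ← integral_Ioc_eq_integral_Ioo, ← intervalIntegral.integral_of_le (by linarith),
    intervalIntegral.integral_const_mul]
  congr 1
  have h2 := intervalIntegral.integral_comp_add_div (a := u) (b := v)
    (reversalDensity lam n t) (c := 2) (by norm_num) ((t : ℝ) / 2)
  simp only [← add_div] at h2
  rw [h2]
  simp

end

/-! ### The terminating hypergeometric function -/

theorem inv_factorial_mul_ascPochhammer_eval_neg (k n : ℕ) :
    ((n.factorial : ℝ))⁻¹ * (ascPochhammer ℝ n).eval (-(k : ℝ)) = (-1) ^ n * k.choose n := by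
  have h : (n.factorial : ℝ) ≠ 0 := by exact_mod_cast n.factorial_ne_zero
  rw [ascPochhammer_eval_neg_eq_descPochhammer, descPochhammer_eval_eq_descFactorial,
    Nat.descFactorial_eq_factorial_mul_choose]
  push_cast
  field_simp

theorem ascPochhammer_eval_half_div (n : ℕ) :
    (ascPochhammer ℝ n).eval (1 / 2 : ℝ) * ((ascPochhammer ℝ n).eval (3 / 2 : ℝ))⁻¹ =
      1 / (2 * n + 1) := by
  have hpos : ∀ n : ℕ, 0 < (ascPochhammer ℝ n).eval (3 / 2 : ℝ) := fun n =>
    ascPochhammer_pos n _ (by norm_num)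
  induction n with
  | zero => simp
  | succ n ih =>
    have h1 := (hpos n).ne'
    rw [← div_eq_mul_inv, div_eq_div_iff h1 (by positivity)] at ih
    rw [← div_eq_mul_inv, div_eq_div_iff (hpos _).ne' (by positivity), ascPochhammer_succ_eval,
      ascPochhammer_succ_eval]
    push_cast
    linear_combination (n + 3 / 2 : ℝ) * ih

theorem ordinaryHypergeometric_neg_nat_half (k : ℕ) (z : ℝ) :
    ordinaryHypergeometric (-(k : ℝ)) (1 / 2 : ℝ) (3 / 2 : ℝ) z =
      ∑ n ∈ Finset.range (k + 1), (-1) ^ n * k.choose n / (2 * n + 1) * z ^ n := by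
  have hterm : ∀ n : ℕ, ordinaryHypergeometricCoefficient (-(k : ℝ)) (1 / 2 : ℝ) (3 / 2 : ℝ) n =
      (-1) ^ n * k.choose n / (2 * n + 1) := by
    intro n
    unfold ordinaryHypergeometricCoefficient
    rw [inv_factorial_mul_ascPochhammer_eval_neg, mul_assoc, ascPochhammer_eval_half_div]
    ring
  rw [ordinaryHypergeometric_eq_tsum]
  simp only
  rw [tsum_eq_sum (s := Finset.range (k + 1))]
  · refine Finset.sum_congr rfl fun n _ => ?_
    rw [smul_eq_mul, ← hterm]
  · intro n hn
    have : k < n := by simpa using hn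
    have h2 := hterm n
    rw [Nat.choose_eq_zero_of_lt this] at h2
    unfold ordinaryHypergeometricCoefficient at h2
    rw [h2]
    simp

/-- Binomial expansion integrated term by term: `∫ x^(2n)` produces the `1 / (2n + 1)` that equals
`(1/2)_n / (3/2)_n`, while `(-k)_n / n!` is the signed binomial coefficient. -/
theorem integral_one_sub_sq_div_pow (k : ℕ) (t v : ℝ) :
    ∫ x in (0 : ℝ)..v, (1 - x ^ 2 / t ^ 2) ^ k =
      v * ordinaryHypergeometric (-(k : ℝ)) (1 / 2 : ℝ) (3 / 2 : ℝ) (v ^ 2 / t ^ 2) := by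
  have h1 : ∀ x : ℝ, (1 - x ^ 2 / t ^ 2) ^ k = ∑ n ∈ Finset.range (k + 1),
      ((-1) ^ n * k.choose n / (t ^ 2) ^ n) * x ^ (2 * n) := by
    intro x
    rw [sub_eq_neg_add, add_pow]
    refine Finset.sum_congr rfl fun n _ => ?_
    rw [neg_pow, div_pow, pow_mul]
    ring
  simp_rw [h1]
  rw [intervalIntegral.integral_finsetSum fun n _ =>
    (by fun_prop : Continuous fun x : ℝ =>
      ((-1) ^ n * k.choose n / (t ^ 2) ^ n : ℝ) * x ^ (2 * n)).intervalIntegrable _ _,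
    ordinaryHypergeometric_neg_nat_half, Finset.mul_sum]
  refine Finset.sum_congr rfl fun n _ => ?_
  rw [intervalIntegral.integral_const_mul, integral_pow, div_pow, ← pow_mul v]
  push_cast
  ring

/-! ### Symmetrised densities -/

theorem reversalDensity_odd_add (lam : ℝ) (k : ℕ) (t x : ℝ) :
    reversalDensity lam (2 * k) t ((t + x) / 2) + reversalDensity lam (2 * k) t ((t - x) / 2) =
      2 * (Real.exp (-lam * t) * lam ^ (2 * k + 1) *
        (((t ^ 2 - x ^ 2) / 4) ^ k / (k.factorial : ℝ) ^ 2)) := by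
  have h1 : (2 * k + 1) / 2 = k := by omega
  have h2 : 2 * k / 2 = k := by omega
  have h3 : t - (t + x) / 2 = (t - x) / 2 := by ring
  have h4 : t - (t - x) / 2 = (t + x) / 2 := by ring
  have h5 : ((t ^ 2 - x ^ 2) / 4) ^ k = ((t + x) / 2) ^ k * ((t - x) / 2) ^ k := by
    rw [← mul_pow]; congr 1; ring
  unfold reversalDensity
  rw [h1, h2, h3, h4, h5]
  ring

/-- The two terms share the product of the `k`-th powers of `(t + x) / 2` and `(t - x) / 2`; the
extra single powers add up to `t`. -/
theorem reversalDensity_even_add (lam : ℝ) (k : ℕ) (t x : ℝ) :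
    reversalDensity lam (2 * k + 1) t ((t + x) / 2) +
        reversalDensity lam (2 * k + 1) t ((t - x) / 2) =
      Real.exp (-lam * t) * lam ^ (2 * k + 2) * t *
        (((t ^ 2 - x ^ 2) / 4) ^ k / ((k + 1) * (k.factorial : ℝ) ^ 2)) := by
  have h1 : (2 * k + 1 + 1) / 2 = k + 1 := by omega
  have h2 : (2 * k + 1) / 2 = k := by omega
  have h3 : t - (t + x) / 2 = (t - x) / 2 := by ring
  have h4 : t - (t - x) / 2 = (t + x) / 2 := by ring
  have h5 : ((t ^ 2 - x ^ 2) / 4) ^ k = ((t + x) / 2) ^ k * ((t - x) / 2) ^ k := by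
    rw [← mul_pow]; congr 1; ring
  have h6 : (k.factorial : ℝ) ≠ 0 := by exact_mod_cast k.factorial_ne_zero
  have h7 : (k : ℝ) + 1 ≠ 0 := by positivity
  unfold reversalDensity
  rw [h1, h2, h3, h4, h5, Nat.factorial_succ, pow_succ ((t + x) / 2), pow_succ ((t - x) / 2)]
  generalize ((t + x) / 2) ^ k = A
  generalize ((t - x) / 2) ^ k = B
  push_cast
  field_simp
  ring

theorem reversalDensity_sum (lam : ℝ) (k : ℕ) {t : ℝ} (ht : t ≠ 0) (x : ℝ) :
    (reversalDensity lam (2 * k) t ((t + x) / 2) + reversalDensity lam (2 * k) t ((t - x) / 2)) +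
      (reversalDensity lam (2 * k + 1) t ((t + x) / 2) +
        reversalDensity lam (2 * k + 1) t ((t - x) / 2)) =
      2 * lam * Real.exp (-(lam * t)) * (1 / (k.factorial : ℝ) ^ 2 * (lam * t / 2) ^ (2 * k) *
        (1 + lam * t / (2 * k + 2))) * (1 - x ^ 2 / t ^ 2) ^ k := by
  have h6 : (k.factorial : ℝ) ≠ 0 := by exact_mod_cast k.factorial_ne_zero
  have h7 : (k : ℝ) + 1 ≠ 0 := by positivity
  have h8 : 2 * (k : ℝ) + 2 ≠ 0 := by positivity
  have h9 : ((t ^ 2 - x ^ 2) / 4) ^ k * lam ^ (2 * k) =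
      (lam * t / 2) ^ (2 * k) * (1 - x ^ 2 / t ^ 2) ^ k := by
    rw [pow_mul, pow_mul, ← mul_pow, ← mul_pow]
    congr 1
    field_simp
    ring
  rw [reversalDensity_odd_add, reversalDensity_even_add, neg_mul]
  trans 2 * lam * Real.exp (-(lam * t)) * (1 / (k.factorial : ℝ) ^ 2 *
        (1 + lam * t / (2 * k + 2))) * (((t ^ 2 - x ^ 2) / 4) ^ k * lam ^ (2 * k))
  · field_simp
    ring
  · rw [h9]
    ring

/-! ### Averaging over the direction and summing over the counts -/

theorem HasSum.add_consecutive {f : ℕ → ℝ} {x : ℝ} (h : HasSum f x) :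
    HasSum (fun k => f (2 * k) + f (2 * k + 1)) x := by
  have s0 : Summable fun k => f (2 * k) :=
    h.summable.comp_injective (i := fun k : ℕ => 2 * k) fun i j hij => by simpa using hij
  have s1 : Summable fun k => f (2 * k + 1) :=
    h.summable.comp_injective (i := fun k : ℕ => 2 * k + 1) fun i j hij => by simpa using hij
  rw [← h.tsum_eq, ← tsum_even_add_odd s0 s1]
  exact s0.hasSum.add s1.hasSum

theorem hasSum_measureReal_inter_preimage_singleton {Ω : Type*} [MeasurableSpace Ω] (P : Measure Ω)
    [IsFiniteMeasure P] {f : Ω → ℕ} (hf : Measurable f) (S : Set Ω) :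
    HasSum (fun n => P.real (S ∩ f ⁻¹' {n})) (P.real S) := by
  have hU : (⋃ n, f ⁻¹' {n}) = Set.univ := by ext; simp
  have h1 : ∑' n, P (S ∩ f ⁻¹' {n}) = P S := by
    have h2 := measure_iUnion (μ := P.restrict S) (f := fun n => f ⁻¹' {n})
      (fun i j hij => Set.disjoint_left.2 fun ω hi hj => hij (hi.symm.trans hj))
      (fun n => hf (measurableSet_singleton n))
    rw [hU, Measure.restrict_apply_univ] at h2
    rw [h2]
    refine tsum_congr fun n => ?_
    rw [Measure.restrict_apply (hf (measurableSet_singleton n)), Set.inter_comm]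
  have h3 := ENNReal.hasSum_toReal (f := fun n => P (S ∩ f ⁻¹' {n})) (by rw [h1]; simp)
  rw [← ENNReal.tsum_toReal_eq (by simp), h1] at h3
  exact h3

section
variable {Ω : Type*} [MeasurableSpace Ω] {P : Measure Ω} [IsProbabilityMeasure P]
  {N : ℝ≥0 → Ω → ℕ} {lam : ℝ≥0}

theorem ae_eq_one_or_neg_one {D : Ω → ℝ} (hD : Measurable D) (h1 : P {ω | D ω = 1} = 1 / 2)
    (h2 : P {ω | D ω = -1} = 1 / 2) : ∀ᵐ ω ∂P, D ω = 1 ∨ D ω = -1 := by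
  have hm : MeasurableSet {ω | D ω = -1} := hD (measurableSet_singleton (-1 : ℝ))
  have hm' : MeasurableSet {ω | D ω = 1} := hD (measurableSet_singleton (1 : ℝ))
  have hd : Disjoint {ω | D ω = 1} {ω | D ω = -1} := Set.disjoint_left.2 fun ω ha hb => by
    have ha : D ω = 1 := ha
    have hb : D ω = -1 := hb
    linarith
  have h3 : P ({ω | D ω = 1} ∪ {ω | D ω = -1}) = 1 := by
    rw [measure_union hd hm, h1, h2, ENNReal.add_halves]
  have h4 := (prob_compl_eq_zero_iff (hm'.union hm)).2 h3
  filter_upwards [compl_mem_ae_iff.2 h4] with ω hω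
  exact or_iff_not_imp_left.2 (by simpa using hω)

/-- The probability that a telegraph process lies in an interval on the event of `n + 1`
reversals. -/
theorem measureReal_directed_signedTime (hN : IsPoissonProcess N lam P) {D : Ω → ℝ}
    (hD : Measurable D) (h1 : P {ω | D ω = 1} = 1 / 2) (h2 : P {ω | D ω = -1} = 1 / 2)
    (hind : IndepFun D (fun ω t => N t ω) P) (n : ℕ) (t : ℝ≥0)
    {u v : ℝ} (hu : -(t : ℝ) ≤ u) (huv : u ≤ v) (hv : v ≤ t) :
    P.real ({ω | D ω * signedTime (fun s => N s ω) t ∈ Set.Ioo u v} ∩ N t ⁻¹' {n + 1}) =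
      1 / 4 * ∫ x in u..v,
        (reversalDensity lam n t ((t + x) / 2) + reversalDensity lam n t ((t - x) / 2)) := by
  have hc := continuous_reversalDensity lam n t
  have r1 : P.real (D ⁻¹' {1}) = 1 / 2 := by
    change (P {ω | D ω = 1}).toReal = _
    rw [h1]; simp
  have r2 : P.real (D ⁻¹' {-1}) = 1 / 2 := by
    change (P {ω | D ω = -1}).toReal = _
    rw [h2]; simp
  have e1 := hN.measureReal_signedTime_mem_Ioo hD hind 1 n t hu huv hv
  -- For `D = -1` the signed time must lie in the reflected interval. The constant `1 / 4` is the
  -- probability `1 / 2` of a direction times the Jacobian `1 / 2` of `x = 2y - t`.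
  have e2 := hN.measureReal_signedTime_mem_Ioo hD hind (-1) n t (u := -v) (v := -u)
    (by linarith) (by linarith) (by linarith)
  have e3 := intervalIntegral.integral_comp_neg (a := u) (b := v)
    (fun x => reversalDensity lam n t ((t + x) / 2))
  simp only [← sub_eq_add_neg] at e3
  rw [r1] at e1
  rw [r2, ← e3] at e2
  rw [← measureReal_inter_add_sdiff (s := {ω | D ω * signedTime (fun s => N s ω) t ∈ Set.Ioo u v} ∩
    N t ⁻¹' {n + 1}) (hD (measurableSet_singleton (1 : ℝ))), intervalIntegral.integral_add
      ((by fun_prop : Continuous fun x : ℝ =>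
        reversalDensity lam n t ((t + x) / 2)).intervalIntegrable _ _)
      ((by fun_prop : Continuous fun x : ℝ =>
        reversalDensity lam n t ((t - x) / 2)).intervalIntegrable _ _)]
  have s1 : ({ω | D ω * signedTime (fun s => N s ω) t ∈ Set.Ioo u v} ∩ N t ⁻¹' {n + 1}) ∩
      D ⁻¹' {1} = (fun ω => signedTime (fun s => N s ω) t) ⁻¹' Set.Ioo u v ∩
        (N t ⁻¹' {n + 1} ∩ D ⁻¹' {1}) := by
    ext ω
    simp only [Set.mem_inter_iff, Set.mem_ofPred_eq, Set.mem_preimage, Set.mem_singleton_iff]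
    constructor
    · rintro ⟨⟨ha, hb⟩, hc⟩
      rw [hc, one_mul] at ha
      exact ⟨ha, hb, hc⟩
    · rintro ⟨ha, hb, hc⟩
      rw [hc, one_mul]
      exact ⟨⟨ha, hb⟩, rfl⟩
  have s2 : (({ω | D ω * signedTime (fun s => N s ω) t ∈ Set.Ioo u v} ∩ N t ⁻¹' {n + 1}) \
      D ⁻¹' {1} : Set Ω) =ᵐ[P] ((fun ω => signedTime (fun s => N s ω) t) ⁻¹' Set.Ioo (-v) (-u) ∩
        (N t ⁻¹' {n + 1} ∩ D ⁻¹' {-1}) : Set Ω) := by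
    refine Filter.eventuallyEq_set.2 ?_
    filter_upwards [ae_eq_one_or_neg_one hD h1 h2] with ω hω
    simp only [Set.mem_sdiff, Set.mem_inter_iff, Set.mem_ofPred_eq, Set.mem_preimage,
      Set.mem_singleton_iff, Set.mem_Ioo]
    rcases hω with hω | hω <;> rw [hω]
    · norm_num
    · constructor
      · rintro ⟨⟨⟨ha, hb⟩, hc⟩, -⟩
        exact ⟨⟨by linarith, by linarith⟩, hc, rfl⟩
      · rintro ⟨⟨ha, hb⟩, hc, -⟩
        exact ⟨⟨⟨by linarith, by linarith⟩, hc⟩, by norm_num⟩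
  rw [s1, measureReal_congr s2, e1, e2]
  ring

/-- Without reversals the directed signed time is `t` or `-t`, which no open interval inside `[-t,
t]` contains. -/
theorem measureReal_directed_signedTime_zero (hN : IsPoissonProcess N lam P) {D : Ω → ℝ}
    (hD : ∀ᵐ ω ∂P, D ω = 1 ∨ D ω = -1) (t : ℝ≥0) {u v : ℝ} (hu : -(t : ℝ) ≤ u) (hv : v ≤ t) :
    P.real ({ω | D ω * signedTime (fun s => N s ω) t ∈ Set.Ioo u v} ∩ N t ⁻¹' {0}) = 0 := by
  rw [measureReal_eq_zero_iff]
  refine compl_mem_ae_iff.1 ?_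
  filter_upwards [hN.monotone, hN.zero, hD] with ω hm h0 hω
  rintro ⟨⟨ha, hb⟩, hn⟩
  have hn : N t ω = 0 := hn
  have h3 := integral_neg_one_pow_of_eq hm (zero_le (a := t)) (h0.trans hn.symm)
  have h4 : signedTime (fun s => N s ω) t = t := by
    unfold signedTime
    rw [NNReal.coe_zero] at h3
    rw [h3, h0]
    simp
  rw [h4] at ha hb
  rcases hω with h | h <;> rw [h] at ha hb <;> linarith

end

theorem proposition1 {Ω : Type*} [MeasurableSpace Ω] (P : Measure Ω) [IsProbabilityMeasure P]
    (c : ℝ) (hc : 0 < c) (lam : ℝ≥0) (hlam : 0 < lam)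
    (X : ℝ≥0 → Ω → ℝ) (hX : IsTelegraphProcess X c lam P)
    (t : ℝ≥0) (ht : 0 < t) (a b : ℝ) (hab : a < b)
    (hmeet : (Set.Ioo a b ∩ Set.Ioo (-(c * t)) (c * t)).Nonempty)
    (α β : ℝ) (hα : α = max (-(c * t)) a) (hβ : β = min (c * t) b)
    (u : ℕ → ℝ)
    (hu : ∀ k : ℕ, u k =
      1 / (k.factorial : ℝ) ^ 2 * ((lam : ℝ) * t / 2) ^ (2 * k) * (1 + (lam : ℝ) * t / (2 * k + 2)) *
        (β * ordinaryHypergeometric (-(k : ℝ)) (1 / 2 : ℝ) (3 / 2 : ℝ) (β ^ 2 / (c ^ 2 * (t : ℝ) ^ 2))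
          - α * ordinaryHypergeometric (-(k : ℝ)) (1 / 2 : ℝ) (3 / 2 : ℝ)
              (α ^ 2 / (c ^ 2 * (t : ℝ) ^ 2)))) :
    Summable u ∧
      P.real {ω | X t ω ∈ Set.Ioo a b ∩ Set.Ioo (-(c * t)) (c * t)} =
        (lam : ℝ) * Real.exp (-((lam : ℝ) * t)) / (2 * c) * ∑' k : ℕ, u k := by
  obtain ⟨D, N, hD, h1, h2, hN, hind, hXt⟩ := hX
  have ht' : (0 : ℝ) < t := by exact_mod_cast ht
  have hlam' : (0 : ℝ) < lam := by exact_mod_cast hlam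
  have hint : Set.Ioo a b ∩ Set.Ioo (-(c * t)) (c * t) = Set.Ioo α β := by
    rw [Set.Ioo_inter_Ioo, hα, hβ, max_comm, min_comm]
  have hαβ : α < β := by
    rw [hint] at hmeet
    exact Set.nonempty_Ioo.1 hmeet
  have hu' : -(t : ℝ) ≤ α / c := by
    rw [le_div_iff₀ hc, hα]
    exact le_trans (by linarith) (le_max_left _ _)
  have hv' : β / c ≤ t := by
    rw [div_le_iff₀ hc, hβ]
    exact (min_le_left _ _).trans (by linarith)
  have huv : α / c ≤ β / c := by gcongr
  set S : Set Ω := {ω | D ω * signedTime (fun s => N s ω) t ∈ Set.Ioo (α / c) (β / c)} with hS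
  have hevent : P.real {ω | X t ω ∈ Set.Ioo a b ∩ Set.Ioo (-(c * t)) (c * t)} = P.real S := by
    refine measureReal_congr (Filter.eventuallyEq_set.2 ?_)
    filter_upwards [hXt] with ω hω
    have h3 : X t ω = c * (D ω * signedTime (fun s => N s ω) t) := by
      rw [hω, intervalIntegral.integral_const_mul, mul_assoc]
      rfl
    rw [hint]
    simp only [hS, Set.mem_ofPred_eq, Set.mem_Ioo, h3, div_lt_iff₀ hc, lt_div_iff₀ hc]
    rw [mul_comm c]
  have hsum := hasSum_measureReal_inter_preimage_singleton P (hN.measurable t) S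
  have hsum1 := (hasSum_nat_add_iff' 1).2 hsum
  rw [Finset.sum_range_one, measureReal_directed_signedTime_zero hN
    (ae_eq_one_or_neg_one hD h1 h2) t hu' hv', sub_zero] at hsum1
  set C : ℝ := (lam : ℝ) * Real.exp (-((lam : ℝ) * t)) / (2 * c) with hC
  have hC0 : C ≠ 0 := by positivity
  -- After the count `0` is dropped, the terms are paired as `2k + 1` and `2k + 2`, matching
  -- `reversalDensity_sum`.
  have hterm : ∀ k : ℕ, P.real (S ∩ N t ⁻¹' {2 * k + 1}) + P.real (S ∩ N t ⁻¹' {2 * k + 1 + 1}) =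
      C * u k := by
    intro k
    have hF : ∀ w : ℝ, ∫ x in (0 : ℝ)..w / c, (1 - x ^ 2 / (t : ℝ) ^ 2) ^ k =
        w * ordinaryHypergeometric (-(k : ℝ)) (1 / 2 : ℝ) (3 / 2 : ℝ)
          (w ^ 2 / (c ^ 2 * (t : ℝ) ^ 2)) / c := by
      intro w
      rw [integral_one_sub_sq_div_pow, div_pow, div_div]
      ring
    have hi : ∀ a b : ℝ, IntervalIntegrable (fun x : ℝ => (1 - x ^ 2 / (t : ℝ) ^ 2) ^ k)
        volume a b := fun a b => Continuous.intervalIntegrable (by fun_prop) _ _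
    have hcd := fun n => continuous_reversalDensity lam n t
    have hi' : ∀ n, IntervalIntegrable (fun x : ℝ => reversalDensity lam n t ((t + x) / 2) +
        reversalDensity lam n t ((t - x) / 2)) volume (α / c) (β / c) := fun n =>
      Continuous.intervalIntegrable (((hcd n).comp (by fun_prop)).add ((hcd n).comp (by fun_prop)))
        _ _
    rw [measureReal_directed_signedTime hN hD h1 h2 hind _ t hu' huv hv',
      measureReal_directed_signedTime hN hD h1 h2 hind _ t hu' huv hv', ← mul_add,
      ← intervalIntegral.integral_add (hi' _) (hi' _)]
    simp_rw [reversalDensity_sum lam k ht'.ne']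
    rw [intervalIntegral.integral_const_mul,
      ← intervalIntegral.integral_interval_sub_left (hi 0 _) (hi 0 _), hF, hF, hu, hC]
    ring
  -- Convergence of the series comes from countable additivity, with no estimate of `u k`.
  have hp : HasSum (fun k => C * u k) (P.real S) := by
    rw [← funext hterm]
    exact hsum1.add_consecutive
  refine ⟨(summable_mul_left_iff hC0).1 hp.summable, ?_⟩
  rw [hevent, ← hp.tsum_eq, tsum_mul_left]
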